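/- Let $\hat{\mathbb C}=\mathbb C\cup\{\infty\}$ be the Riemann sphere, and let $f,g:\hat{\mathbb C}\to\hat{\mathbb C}$ be Möbius transformations $z\mapsto (az+b)/(cz+d)$ with $a,b,c,d\in\mathbb C$, $ad-bc\neq 0$, neither of which is the identity. Let $M_f=\frac{1}{\sqrt{ad-bc}}\begin{bmatrix}a&b\\c&d\end{bmatrix}$ be a matrix of determinant $1$ that gives $f$ (it is determined by $f$ up to sign), and let $M_g$ be such a matrix for $g$. A multiplier of $f$ is a number $\mu$ that equals $f'(z_0)$ for some fixed point $z_0\in\mathbb C$ of $f$, or equals $\lim_{z\to\infty}1/f'(z)$ if $\infty$ is a fixed point of $f$; multipliers of $g$ are defined likewise. The following four statements are equivalent. (i) $f$ and $g$ are topologically conjugate, i.e. there is a homeomorphism $h:\hat{\mathbb C}\to\hat{\mathbb C}$ such that $g=h^{-1}\circ f\circ h$. (ii) Both $\operatorname{tr}M_f$ and $\operatorname{tr}M_g$ lie outside $[-2,2]$, or $\operatorname{tr}M_f=\pm\operatorname{tr}M_g$. Here $[-2,2]$ is the set of all $a\in\mathbb R\subset\mathbb C$ with $-2\le a\le 2$.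 (iii) For every eigenvalue $\lambda$ of $M_f$ and every eigenvalue $\lambda'$ of $M_g$: both $|\lambda|\ne 1$ and $|\lambda'|\neq 1$, or $\lambda=\pm\lambda'$, or $\lambda=\pm\overline{\lambda'}$. (iv) For every multiplier $\mu$ of $f$ and every multiplier $\nu$ of $g$: both $|\mu|\neq 1$ and $|\nu|\ne 1$, or $\mu=\nu$, or $\mu=\bar\nu$. -/

import Mathlib

open scoped MatrixGroups

noncomputable section

/-- `f : ℂ ∪ {∞} → ℂ ∪ {∞}` is a Möbius transformation `z ↦ (a z + b) / (c z + d)`, `a d - b c ≠ 0`.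
Here `A • z` is the action of invertible matrices by linear fractional maps. -/
def IsMobius (f : OnePoint ℂ → OnePoint ℂ) : Prop :=
  ∃ A : GL (Fin 2) ℂ, ∀ z : OnePoint ℂ, f z = A • z

/-- `M` is a matrix of determinant `1` that gives the Möbius transformation `f`
(such a matrix is unique up to sign). -/
def IsUnitMatrixOf (M : SL(2, ℂ)) (f : OnePoint ℂ → OnePoint ℂ) : Prop :=
  ∀ z : OnePoint ℂ, f z = (M : GL (Fin 2) ℂ) • z

/-- Every Möbius transformation is given by a matrix of determinant `1`. -/
theorem IsMobius.exists_isUnitMatrixOf {f : OnePoint ℂ → OnePoint ℂ} (hf : IsMobius f) :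
    ∃ M : SL(2, ℂ), IsUnitMatrixOf M f := by
  obtain ⟨A, hA⟩ := hf
  obtain ⟨s, hs⟩ := IsAlgClosed.exists_pow_nat_eq (A.1.det) (n := 2) (by norm_num)
  have hd : A.1.det ≠ 0 := A.det_ne_zero
  have hs0 : s ≠ 0 := by rintro rfl; apply hd; rw [← hs]; simp
  let M : SL(2, ℂ) := ⟨s⁻¹ • A.1, by rw [Matrix.det_smul, ← hs]; simp; field_simp⟩
  have hM : ∀ i j, (M : GL (Fin 2) ℂ) i j = s⁻¹ * A i j := fun _ _ => rfl
  refine ⟨M, fun z => ?_⟩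
  rw [hA]
  cases z with
  | infty =>
    rw [OnePoint.smul_infty_eq_ite, OnePoint.smul_infty_eq_ite, hM, hM,
      mul_div_mul_left _ _ (inv_ne_zero hs0)]
    simp [hs0]
  | coe z =>
    rw [OnePoint.smul_some_eq_ite, OnePoint.smul_some_eq_ite, hM, hM, hM, hM, mul_assoc, mul_assoc,
      ← mul_add, ← mul_add, mul_div_mul_left _ _ (inv_ne_zero hs0)]
    simp [hs0]

/-- Topological conjugacy of self-maps: `g = h⁻¹ ∘ f ∘ h` for a homeomorphism `h`. -/
def TopologicallyConjugate {X : Type*} [TopologicalSpace X] (f g : X → X) : Prop :=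
  ∃ h : X ≃ₜ X, g = h.symm ∘ f ∘ h

/-- The restriction of `f` to the finite plane as a complex-valued function
(with value `0` at the points that `f` sends to `∞`). -/
def finitePart (f : OnePoint ℂ → OnePoint ℂ) (z : ℂ) : ℂ :=
  (f (z : OnePoint ℂ)).elim 0 id

/-- `μ` is a multiplier of `f`: either `f'(z₀)` at a fixed point `z₀ ∈ ℂ`,
or `lim_{z → ∞} 1 / f'(z)` if `∞` is a fixed point. -/
def IsMultiplier (f : OnePoint ℂ → OnePoint ℂ) (μ : ℂ) : Prop :=
  (∃ z₀ : ℂ, f (z₀ : OnePoint ℂ) = (z₀ : OnePoint ℂ) ∧ HasDerivAt (finitePart f) μ z₀) ∨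
  (f OnePoint.infty = OnePoint.infty ∧
    Filter.Tendsto (fun z : ℂ => 1 / deriv (finitePart f) z) (Bornology.cobounded ℂ) (nhds μ))

/-- The real segment `[-2, 2]` in the complex plane. -/
def segmentNegTwoTwo : Set ℂ := {z | ∃ a : ℝ, -2 ≤ a ∧ a ≤ 2 ∧ z = (a : ℂ)}

end

/-! A nonidentity Möbius map is conjugate to `z ↦ l²z` if `l² ≠ 1` and to `z ↦ z + 1` if `l² = 1`,
where `l` is an eigenvalue of its unit matrix (`IsUnitMatrixOf.exists_normalForm`). It remains to
classify these models. The translation has one fixed point, every dilation at least two. Dilations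
with factor off the unit circle are all conjugate to doubling, by inversion and the radial twists `z
↦ z |z| ^ s` (`sphereAffine_conj_two`). Nontrivial rotations are not among them, because their
orbits in the punctured plane stay on compact circles (`norm_eq_one_of_conj`). The hard point is
that conjugate rotations have equal or inverse factors. A conjugacy fixing `0` and `∞` lifts through
`exp` to a map commuting with the period up to a degree `d = ±1`; comparing growth along the
imaginary axis gives `m = k ^ d` (`rotation_eq_or_eq_inv`). The rest is algebra: the trace is `l +
l⁻¹`, the multipliers are the squares `l²`, and inversion is conjugation on the unit circle. -/

/-! ### Lifting through the exponential; rotations of the plane. -/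

open Complex in
/-- Every continuous nonvanishing function on the plane has a continuous logarithm. -/
theorem exists_continuous_log {F : ℂ → ℂ} (hF : Continuous F) (h0 : ∀ z, F z ≠ 0) :
    ∃ H : ℂ → ℂ, Continuous H ∧ ∀ z, exp (H z) = F z := by
  obtain ⟨H, ⟨-, hH⟩, -⟩ := isCoveringMapOn_exp.existsUnique_continuousMap_lifts (a₀ := (0 : ℂ))
    ⟨F, hF⟩ (exp_log (h0 0)) (fun z => h0 z)
  exact ⟨H, H.continuous, fun z => congrFun hH z⟩

open Complex in
/-- Two continuous logarithms of the same function differ by a constant multiple of `2πi`. -/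
theorem exists_int_of_exp_eq {G G' : ℂ → ℂ} (hG : Continuous G) (hG' : Continuous G')
    (h : ∀ z, exp (G z) = exp (G' z)) :
    ∃ n : ℤ, ∀ z, G z = G' z + n * (2 * Real.pi * I) := by
  choose n hn using fun z => exp_eq_exp_iff_exists_int.1 (h z)
  have hpi : (2 * Real.pi * I : ℂ) ≠ 0 := two_pi_I_ne_zero
  have hc : Continuous fun z => (n z : ℝ) := by
    have : (fun z => (n z : ℝ)) = fun z => ((G z - G' z) / (2 * Real.pi * I)).re := by
      funext z
      rw [hn z, add_sub_cancel_left, mul_div_cancel_right₀ _ hpi, intCast_re]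
    rw [this]
    fun_prop
  have hc' : Continuous n := Int.isClosedEmbedding_coe_real.isEmbedding.continuous_iff.2 hc
  refine ⟨n 0, fun z => ?_⟩
  rw [hn z, PreconnectedSpace.constant inferInstance hc' (x := z) (y := 0)]

theorem Continuous.exists_norm_le_of_periodic {E : Type*} [NormedAddCommGroup E] {f : ℝ → E}
    (hf : Continuous f) {c : ℝ} (hc : 0 < c) (hp : Function.Periodic f c) :
    ∃ C, ∀ t, ‖f t‖ ≤ C := by
  obtain ⟨C, hC⟩ := (isCompact_Icc (a := (0 : ℝ)) (b := c)).exists_bound_of_continuousOn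
    hf.continuousOn
  refine ⟨C, fun t => ?_⟩
  obtain ⟨s, hs, hst⟩ := hp.exists_mem_Ico₀ hc t
  rw [hst]
  exact hC s ⟨hs.1, hs.2.le⟩

theorem eq_zero_of_forall_norm_natCast_mul_le {v : ℂ} {C : ℝ} (h : ∀ n : ℕ, ‖(n : ℂ) * v‖ ≤ C) :
    v = 0 := by
  by_contra hv
  obtain ⟨n, hn⟩ := exists_nat_gt (C / ‖v‖)
  have h1 := h n
  rw [norm_mul, Complex.norm_natCast] at h1
  rw [div_lt_iff₀ (norm_pos_iff.2 hv)] at hn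
  linarith

open Complex in
/-- A continuous self-map of the plane that preserves `ℂ \ {0}` and has degree `d` there can
semiconjugate the rotation by `k` only to the rotation by `k ^ d`. -/
theorem eq_zpow_of_semiconj_rotation {φ H : ℂ → ℂ} (hH : Continuous H)
    (hφH : ∀ w, exp (H w) = φ (exp w)) {d : ℤ}
    (hd : ∀ w, H (w + 2 * Real.pi * I) = H w + d * (2 * Real.pi * I))
    {k m : ℂ} (hk : ‖k‖ = 1) (hm : m ≠ 0) (hconj : ∀ z, φ (k * z) = m * φ z) :
    m = k ^ d := by
  have hkβ : exp (k.arg * I) = k := by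
    simpa [hk] using norm_mul_exp_arg_mul_I k
  have hmα : exp (log m) = m := exp_log hm
  set β : ℝ := k.arg
  -- Both sides are continuous logarithms of `φ (k * exp w) = m * φ (exp w)`.
  obtain ⟨j, hj⟩ := exists_int_of_exp_eq (G := fun w => H (w + β * I)) (G' := fun w => H w + log m)
    (by fun_prop) (by fun_prop) (fun w => by
      rw [hφH, exp_add, exp_add, hφH, hkβ, hmα, mul_comm, hconj, mul_comm])
  have hiter : ∀ n : ℕ, H (n * (β * I)) = H 0 + n * (log m + j * (2 * Real.pi * I)) := by
    intro n
    induction n with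
    | zero => simp
    | succ n ih =>
      have := hj (n * (β * I))
      push_cast
      rw [add_mul, one_mul, this, ih]
      ring
  -- Removing the linear part of slope `d` leaves a periodic function on the imaginary axis.
  obtain ⟨C, hC⟩ := Continuous.exists_norm_le_of_periodic
    (f := fun t : ℝ => H (t * I) - d * (t * I)) (by fun_prop) Real.two_pi_pos (fun t => by
      have := hd (t * I)
      push_cast
      rw [add_mul, this]
      ring)
  -- After `n` rotations the discrepancy is `n` times this vector, yet it stays bounded.
  have hv : log m + j * (2 * Real.pi * I) - d * (β * I) = 0 := by
    refine eq_zero_of_forall_norm_natCast_mul_le (C := C + ‖H 0‖) fun n => ?_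
    have h1 := hC (n * β)
    have h2 : (n : ℂ) * (log m + j * (2 * Real.pi * I) - d * (β * I)) =
        (H ((n * β : ℝ) * I) - d * ((n * β : ℝ) * I)) - H 0 := by
      push_cast
      rw [mul_assoc (n : ℂ), hiter n]
      ring
    rw [h2]
    exact (norm_sub_le _ _).trans (by linarith)
  have h3 : log m = d * (β * I) - j * (2 * Real.pi * I) := by linear_combination hv
  rw [← hmα, h3, exp_sub, exp_int_mul_two_pi_mul_I, div_one, exp_int_mul, hkβ]

open Complex in
/-- Topologically conjugate rotations of the plane about the origin have the same angle up to
sign. -/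
theorem rotation_eq_or_eq_inv {φ ψ : ℂ → ℂ} (hφ : Continuous φ) (hψ : Continuous ψ)
    (hψφ : ∀ z, ψ (φ z) = z) (hφψ : ∀ z, φ (ψ z) = z) (h0 : φ 0 = 0)
    {k m : ℂ} (hk : ‖k‖ = 1) (hm : m ≠ 0) (hconj : ∀ z, φ (k * z) = m * φ z) :
    m = k ∨ m = k⁻¹ := by
  have hψ0 : ψ 0 = 0 := by rw [← h0, hψφ, h0]
  have hφ_ne : ∀ z, φ (exp z) ≠ 0 := fun z hz =>
    exp_ne_zero z (by rw [← hψφ (exp z), hz, hψ0])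
  have hψ_ne : ∀ z, ψ (exp z) ≠ 0 := fun z hz =>
    exp_ne_zero z (by rw [← hφψ (exp z), hz, h0])
  obtain ⟨H, hHc, hH⟩ := exists_continuous_log (hφ.comp continuous_exp) hφ_ne
  obtain ⟨K, hKc, hK⟩ := exists_continuous_log (hψ.comp continuous_exp) hψ_ne
  simp only [Function.comp_apply] at hH hK
  obtain ⟨d, hd⟩ := exists_int_of_exp_eq (G := fun w => H (w + 2 * Real.pi * I)) (G' := H)
    (by fun_prop) hHc (fun w => by rw [hH, hH, exp_add, exp_two_pi_mul_I, mul_one])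
  obtain ⟨e, he⟩ := exists_int_of_exp_eq (G := fun w => K (w + 2 * Real.pi * I)) (G' := K)
    (by fun_prop) hKc (fun w => by rw [hK, hK, exp_add, exp_two_pi_mul_I, mul_one])
  obtain ⟨n, hn⟩ := exists_int_of_exp_eq (G := fun w => K (H w)) (G' := id)
    (by fun_prop) continuous_id (fun w => by rw [hK, hH, hψφ, id])
  have hper : Function.Periodic (fun v => K v - e * v) (2 * Real.pi * I) := fun v => by
    simp only [he]
    ring
  -- Degrees multiply: one period of the argument shifts `H` by `d` periods, hence `K ∘ H` by `d *
  -- e`; but `K ∘ H` is the identity up to a constant.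
  have hde : d * e = 1 := by
    have h1 := hn (2 * Real.pi * I)
    have h2 := hn 0
    have h3 := hd 0
    have h4 := hper.int_mul d (H 0)
    simp only [id, zero_add] at h1 h2 h3 h4
    rw [h3] at h1
    rw [h1] at h4
    rw [h2] at h4
    have h5 : ((d * e : ℤ) : ℂ) * (2 * Real.pi * I) = (1 : ℤ) * (2 * Real.pi * I) := by
      push_cast
      linear_combination -h4
    exact_mod_cast mul_right_cancel₀ two_pi_I_ne_zero h5
  have hmk := eq_zpow_of_semiconj_rotation hHc hH hd hk hm hconj
  rcases Int.eq_one_or_neg_one_of_mul_eq_one hde with rfl | rfl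
  · left; simpa using hmk
  · right; simpa using hmk

/-! ### Topological conjugacy is an equivalence relation. -/

namespace TopologicallyConjugate

variable {X : Type*} [TopologicalSpace X] {f g k : X → X}

theorem of_semiconj (h : X ≃ₜ X) (H : ∀ x, f (h x) = h (g x)) : TopologicallyConjugate f g :=
  ⟨h, funext fun x => by simp [H]⟩

theorem exists_semiconj (H : TopologicallyConjugate f g) :
    ∃ h : X ≃ₜ X, ∀ x, f (h x) = h (g x) := by
  obtain ⟨h, rfl⟩ := H
  exact ⟨h, fun x => by simp⟩

theorem refl (f : X → X) : TopologicallyConjugate f f := of_semiconj (.refl X) fun _ => rfl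

theorem symm (H : TopologicallyConjugate f g) : TopologicallyConjugate g f := by
  obtain ⟨h, hh⟩ := H.exists_semiconj
  exact of_semiconj h.symm fun x => by
    rw [Homeomorph.eq_symm_apply, ← hh, Homeomorph.apply_symm_apply]

theorem trans (H : TopologicallyConjugate f g) (H' : TopologicallyConjugate g k) :
    TopologicallyConjugate f k := by
  obtain ⟨h, hh⟩ := H.exists_semiconj
  obtain ⟨h', hh'⟩ := H'.exists_semiconj
  exact of_semiconj (h'.trans h) fun x => by simp [hh, hh']

end TopologicallyConjugate

/-! ### Inversion and affine maps of the sphere. -/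

noncomputable section

open Filter Topology OnePoint

/-- The inversion `z ↦ 1 / z` of the Riemann sphere. -/
def sphereInv (z : OnePoint ℂ) : OnePoint ℂ :=
  z.elim ((0 : ℂ) : OnePoint ℂ) fun w => if w = 0 then ∞ else ((w⁻¹ : ℂ) : OnePoint ℂ)

@[simp] theorem sphereInv_infty : sphereInv ∞ = ((0 : ℂ) : OnePoint ℂ) := rfl

@[simp] theorem sphereInv_zero : sphereInv ((0 : ℂ) : OnePoint ℂ) = ∞ := by simp [sphereInv]

theorem sphereInv_coe {w : ℂ} (hw : w ≠ 0) :
    sphereInv (w : OnePoint ℂ) = ((w⁻¹ : ℂ) : OnePoint ℂ) := by simp [sphereInv, hw]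

theorem sphereInv_sphereInv (z : OnePoint ℂ) : sphereInv (sphereInv z) = z := by
  cases z with
  | infty => simp
  | coe w =>
    by_cases hw : w = 0
    · simp [hw]
    · rw [sphereInv_coe hw, sphereInv_coe (inv_ne_zero hw), inv_inv]

theorem continuous_sphereInv : Continuous sphereInv := by
  rw [OnePoint.continuous_iff]
  have hcob : coclosedCompact ℂ = Bornology.cobounded ℂ := by
    rw [coclosedCompact_eq_cocompact, Metric.cobounded_eq_cocompact]
  have hne : ∀ᶠ w : ℂ in Bornology.cobounded ℂ, w ≠ 0 :=
    Bornology.eventually_ne_cobounded 0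
  refine ⟨?_, continuous_iff_continuousAt.2 fun w => ?_⟩
  · rw [hcob, sphereInv_infty]
    refine ((continuous_coe.tendsto _).comp (tendsto_inv₀_cobounded (α := ℂ))).congr' ?_
    filter_upwards [hne] with w hw
    rw [sphereInv_coe hw]
    rfl
  · by_cases hw : w = 0
    · subst hw
      rw [continuousAt_iff_punctured_nhds, sphereInv_zero]
      have h1 : Tendsto ((↑) : ℂ → OnePoint ℂ) (Bornology.cobounded ℂ) (𝓝 ∞) :=
        hcob ▸ tendsto_coe_infty
      refine (h1.comp tendsto_inv₀_nhdsNE_zero).congr' ?_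
      filter_upwards [self_mem_nhdsWithin] with w hw
      rw [sphereInv_coe hw]
      rfl
    · refine (continuous_coe.continuousAt.comp (continuousAt_inv₀ hw)).congr ?_
      filter_upwards [isOpen_ne.mem_nhds hw] with w hw
      rw [sphereInv_coe hw]
      rfl

/-- The inversion of the Riemann sphere as a homeomorphism. -/
def sphereInvHomeomorph : OnePoint ℂ ≃ₜ OnePoint ℂ where
  toFun := sphereInv
  invFun := sphereInv
  left_inv := sphereInv_sphereInv
  right_inv := sphereInv_sphereInv
  continuous_toFun := continuous_sphereInv
  continuous_invFun := continuous_sphereInv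

/-- The map `z ↦ a z + b` of the Riemann sphere fixing `∞`. -/
def sphereAffine (a b : ℂ) : OnePoint ℂ → OnePoint ℂ := OnePoint.map fun z => a * z + b

@[simp] theorem sphereAffine_infty (a b : ℂ) : sphereAffine a b ∞ = ∞ := rfl

@[simp] theorem sphereAffine_coe (a b z : ℂ) :
    sphereAffine a b (z : OnePoint ℂ) = ((a * z + b : ℂ) : OnePoint ℂ) := rfl

theorem topologicallyConjugate_map_of_semiconj {p q : ℂ → ℂ} (h : ℂ ≃ₜ ℂ)
    (H : ∀ z, p (h z) = h (q z)) :
    TopologicallyConjugate (OnePoint.map p) (OnePoint.map q) := by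
  refine .of_semiconj h.onePointCongr fun x => ?_
  cases x with
  | infty => rfl
  | coe z => simp [H]

/-- Translating by the finite fixed point `b / (1 - a)` moves it to `0`. -/
theorem sphereAffine_conj_mul {a : ℂ} (ha : a ≠ 1) (b : ℂ) :
    TopologicallyConjugate (sphereAffine a b) (sphereAffine a 0) := by
  have ha' : 1 - a ≠ 0 := sub_ne_zero.2 ha.symm
  refine topologicallyConjugate_map_of_semiconj (Homeomorph.addRight (b / (1 - a))) fun z => ?_
  simp only [Homeomorph.coe_addRight]
  field_simp
  ring

theorem sphereAffine_one_conj {b : ℂ} (hb : b ≠ 0) :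
    TopologicallyConjugate (sphereAffine 1 b) (sphereAffine 1 1) := by
  refine topologicallyConjugate_map_of_semiconj (Homeomorph.mulLeft₀ b hb) fun z => ?_
  simp
  ring

theorem sphereAffine_conj_inv {a : ℂ} (ha : a ≠ 0) :
    TopologicallyConjugate (sphereAffine a 0) (sphereAffine a⁻¹ 0) := by
  refine .of_semiconj sphereInvHomeomorph fun x => ?_
  change sphereAffine a 0 (sphereInv x) = sphereInv (sphereAffine a⁻¹ 0 x)
  cases x with
  | infty => simp
  | coe z =>
    by_cases hz : z = 0
    · simp [hz]
    · have : a⁻¹ * z ≠ 0 := mul_ne_zero (inv_ne_zero ha) hz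
      rw [sphereAffine_coe, add_zero, sphereInv_coe hz, sphereInv_coe this]
      simp [mul_comm]

/-! ### Radial twists and dilations with factor off the unit circle. -/

/-- The map `z ↦ z |z| ^ s` of the plane. -/
def radialTwist (s z : ℂ) : ℂ := z * (‖z‖ : ℂ) ^ s

theorem norm_radialTwist (s z : ℂ) : ‖radialTwist s z‖ = ‖z‖ * ‖z‖ ^ s.re := by
  by_cases hz : z = 0
  · simp [radialTwist, hz]
  · rw [radialTwist, norm_mul, Complex.norm_cpow_eq_rpow_re_of_pos (norm_pos_iff.2 hz)]

/-- Multiplicativity makes the twist conjugate multiplication by `w` to multiplication by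
`radialTwist s w`. -/
theorem radialTwist_mul (s w z : ℂ) :
    radialTwist s (w * z) = radialTwist s w * radialTwist s z := by
  rw [radialTwist, radialTwist, radialTwist, norm_mul, Complex.ofReal_mul,
    Complex.mul_cpow_ofReal_nonneg (norm_nonneg _) (norm_nonneg _)]
  ring

theorem radialTwist_comp (s t z : ℂ) :
    radialTwist t (radialTwist s z) = radialTwist (s + (1 + s.re) * t) z := by
  by_cases hz : z = 0
  · simp [radialTwist, hz]
  have hz' : (0 : ℝ) < ‖z‖ := norm_pos_iff.2 hz
  have hzc : (‖z‖ : ℂ) ≠ 0 := by exact_mod_cast hz'.ne'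
  have h1 : ((‖z‖ * ‖z‖ ^ s.re : ℝ) : ℂ) ^ t = (‖z‖ : ℂ) ^ ((1 + s.re) * t) := by
    have : ‖z‖ * ‖z‖ ^ s.re = ‖z‖ ^ (1 + s.re) := by rw [Real.rpow_add hz', Real.rpow_one]
    rw [this]
    rw [Complex.cpow_def_of_ne_zero hzc, Complex.cpow_def_of_ne_zero
      (by exact_mod_cast (Real.rpow_pos_of_pos hz' _).ne'), ← Complex.ofReal_log hz'.le,
      ← Complex.ofReal_log (Real.rpow_nonneg hz'.le _), Real.log_rpow hz']
    push_cast
    ring_nf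
  rw [radialTwist, norm_radialTwist, h1, radialTwist, radialTwist, Complex.cpow_add _ _ hzc]
  ring

/-- The modulus of the image is `‖z‖ ^ (1 + s.re)`, so the bound on `s.re` is what gives continuity
at the origin. -/
theorem continuous_radialTwist {s : ℂ} (hs : -1 < s.re) : Continuous (radialTwist s) := by
  refine continuous_iff_continuousAt.2 fun z => ?_
  by_cases hz : z = 0
  · subst hz
    have h0 : radialTwist s 0 = 0 := by simp [radialTwist]
    rw [ContinuousAt, h0, tendsto_zero_iff_norm_tendsto_zero]
    have h1 : ∀ w : ℂ, ‖radialTwist s w‖ = ‖w‖ ^ (1 + s.re) := fun w => by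
      rw [norm_radialTwist, Real.rpow_add' (norm_nonneg w) (by linarith),
        Real.rpow_one]
    simp only [h1]
    have h2 : Continuous fun w : ℂ => ‖w‖ ^ (1 + s.re) :=
      continuous_norm.rpow_const fun _ => Or.inr (by linarith)
    simpa [Real.zero_rpow (by linarith : (1 + s.re) ≠ 0)] using h2.tendsto 0
  · refine continuousAt_id.mul (ContinuousAt.cpow (by fun_prop) continuousAt_const ?_)
    simp [hz]

/-- `radialTwist s` as a homeomorphism. -/
def radialTwistHomeomorph (s : ℂ) (hs : -1 < s.re) : ℂ ≃ₜ ℂ where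
  toFun := radialTwist s
  -- The exponent `t` solves `s + (1 + s.re) * t = 0`, by `radialTwist_comp`.
  invFun := radialTwist (-s / (1 + s.re : ℝ))
  left_inv z := by
    have h : ((1 + s.re : ℝ) : ℂ) ≠ 0 := by exact_mod_cast (by linarith : 1 + s.re ≠ 0)
    have : s + (1 + s.re) * (-s / (1 + s.re : ℝ)) = 0 := by
      push_cast at h ⊢
      field_simp
      ring
    rw [radialTwist_comp, this]
    simp [radialTwist]
  right_inv z := by
    have h' : 1 + s.re ≠ 0 := by linarith
    have h : ((1 + s.re : ℝ) : ℂ) ≠ 0 := by exact_mod_cast h'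
    have : -s / (1 + s.re : ℝ) + (1 + (-s / (1 + s.re : ℝ)).re) * s = 0 := by
      rw [Complex.div_ofReal_re, Complex.neg_re]
      push_cast at h ⊢
      field_simp
      ring
    rw [radialTwist_comp, this]
    simp [radialTwist]
  continuous_toFun := continuous_radialTwist hs
  continuous_invFun := continuous_radialTwist (by
    rw [Complex.div_ofReal_re, Complex.neg_re, lt_div_iff₀ (by linarith)]
    linarith)

theorem sphereAffine_conj_two_of_one_lt_norm {k : ℂ} (hk : 1 < ‖k‖) :
    TopologicallyConjugate (sphereAffine k 0) (sphereAffine 2 0) := by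
  have hk0 : k ≠ 0 := by rintro rfl; norm_num at hk
  have hl : 0 < Real.log 2 := Real.log_pos one_lt_two
  have hlc : (Real.log 2 : ℂ) ≠ 0 := by exact_mod_cast hl.ne'
  -- Chosen so that `2 ^ (1 + s) = k`; the condition `1 < ‖k‖` gives `-1 < s.re`.
  set s : ℂ := Complex.log k / Real.log 2 - 1
  have hs : -1 < s.re := by
    simp only [s, Complex.sub_re, Complex.div_ofReal_re, Complex.log_re, Complex.one_re]
    have : 0 < Real.log ‖k‖ / Real.log 2 := div_pos (Real.log_pos hk) hl
    linarith
  have h2 : radialTwist s 2 = k := by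
    have h2c : (2 : ℂ) = Complex.exp (Real.log 2 : ℝ) := by
      rw [← Complex.ofReal_exp, Real.exp_log two_pos]; norm_num
    have h3 : radialTwist s 2 = (2 : ℂ) ^ (1 + s) := by
      rw [radialTwist, Complex.cpow_add _ _ two_ne_zero, Complex.cpow_one]
      norm_num
    rw [h3, Complex.cpow_def_of_ne_zero two_ne_zero]
    have : Complex.log 2 = (Real.log 2 : ℂ) := by
      rw [Complex.ofReal_log two_pos.le]; norm_num
    rw [this, show (Real.log 2 : ℂ) * (1 + s) = Complex.log k by simp only [s]; field_simp; ring,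
      Complex.exp_log hk0]
  refine topologicallyConjugate_map_of_semiconj (radialTwistHomeomorph s hs) fun z => ?_
  change k * radialTwist s z + 0 = radialTwist s (2 * z + 0)
  rw [add_zero, add_zero, radialTwist_mul, h2]

theorem sphereAffine_conj_two {k : ℂ} (hk0 : k ≠ 0) (hk : ‖k‖ ≠ 1) :
    TopologicallyConjugate (sphereAffine k 0) (sphereAffine 2 0) := by
  rcases lt_or_gt_of_ne hk with h | h
  · refine (sphereAffine_conj_inv hk0).trans (sphereAffine_conj_two_of_one_lt_norm ?_)
    rw [norm_inv]
    exact (one_lt_inv₀ (norm_pos_iff.2 hk0)).2 h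
  · exact sphereAffine_conj_two_of_one_lt_norm h

/-! ### Obstructions to conjugacy. -/

theorem not_topologicallyConjugate_mul_translation (k : ℂ) :
    ¬ TopologicallyConjugate (sphereAffine k 0) (sphereAffine 1 1) := by
  intro H
  obtain ⟨h, hh⟩ := H.symm.exists_semiconj
  have hfix : ∀ x, sphereAffine 1 1 x = x → x = ∞ := fun x hx => by
    cases x with
    | infty => rfl
    | coe z => simp at hx
  have h0 := hfix (h ((0 : ℂ) : OnePoint ℂ)) (by rw [hh]; simp)
  have h1 := hfix (h ∞) (by rw [hh]; simp)
  exact coe_ne_infty _ (h.injective (h0.trans h1.symm))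

/-- Otherwise `m` may be replaced by `1 / 2`. The points `(1 / 2) ^ n` tend to `0`, while their
images `k ^ n * w` lie on a circle of radius `‖w‖ > 0`. By compactness `h 0` is on that circle, but
it is fixed by the rotation and `k ≠ 1`. -/
theorem norm_eq_one_of_conj {k m : ℂ} (hk : ‖k‖ = 1) (hk1 : k ≠ 1) (hm0 : m ≠ 0)
    (H : TopologicallyConjugate (sphereAffine k 0) (sphereAffine m 0)) : ‖m‖ = 1 := by
  by_contra hm
  obtain ⟨h, hh⟩ := (H.trans (sphereAffine_conj_two hm0 hm)).trans
    (sphereAffine_conj_two (k := 1 / 2) (by norm_num) (by norm_num)).symm |>.exists_semiconj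
  have hfix : ∀ z : ℂ, sphereAffine (1 / 2) 0 (z : OnePoint ℂ) = z → z = 0 := fun z hz => by
    simp at hz
    linear_combination -2 * hz
  have h1 : h ((1 : ℂ) : OnePoint ℂ) ≠ ∞ := fun e => by
    have h2 := hh ((1 : ℂ) : OnePoint ℂ)
    rw [e, sphereAffine_infty, ← e] at h2
    exact one_ne_zero (hfix 1 (h.injective h2).symm)
  obtain ⟨w, hw⟩ := ne_infty_iff_exists.1 h1
  have hw0 : w ≠ 0 := by
    rintro rfl
    have h2 := hh ((1 : ℂ) : OnePoint ℂ)
    rw [← hw, sphereAffine_coe, mul_zero, add_zero, hw] at h2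
    exact one_ne_zero (hfix 1 (h.injective h2).symm)
  have hiter : ∀ n : ℕ, h (((1 / 2) ^ n : ℂ) : OnePoint ℂ) = ((k ^ n * w : ℂ) : OnePoint ℂ) := by
    intro n
    induction n with
    | zero => simpa using hw.symm
    | succ n ih =>
      have h2 := hh (((1 / 2) ^ n : ℂ) : OnePoint ℂ)
      rw [ih, sphereAffine_coe, sphereAffine_coe, add_zero, add_zero] at h2
      rw [pow_succ', ← h2, pow_succ', mul_assoc]
  have hlim : Tendsto (fun n : ℕ => ((k ^ n * w : ℂ) : OnePoint ℂ)) atTop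
      (𝓝 (h ((0 : ℂ) : OnePoint ℂ))) := by
    simp only [← hiter]
    refine ((h.continuous.comp continuous_coe).tendsto 0).comp
      (tendsto_pow_atTop_nhds_zero_of_norm_lt_one (by norm_num))
  have hnorm : ∀ n, ‖k ^ n * w‖ = ‖w‖ := fun n => by simp [hk]
  have hp := hh ((0 : ℂ) : OnePoint ℂ)
  simp only [sphereAffine_coe, mul_zero, add_zero] at hp
  have hp' : h ((0 : ℂ) : OnePoint ℂ) ∈ ((↑) : ℂ → OnePoint ℂ) '' Metric.sphere 0 ‖w‖ := by
    have hcl : IsClosed (((↑) : ℂ → OnePoint ℂ) '' Metric.sphere 0 ‖w‖) :=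
      isClosed_image_coe.2 ⟨Metric.isClosed_sphere, isCompact_sphere 0 ‖w‖⟩
    exact hcl.mem_of_tendsto hlim (Eventually.of_forall fun n => ⟨_, by simpa using hnorm n, rfl⟩)
  obtain ⟨p, hpw, hpe⟩ := hp'
  rw [← hpe, sphereAffine_coe, coe_eq_coe, add_zero] at hp
  have hp0 : p = 0 := by
    by_contra hp0
    exact hk1 (mul_right_cancel₀ hp0 (by rw [hp, one_mul]))
  rw [hp0, mem_sphere_zero_iff_norm, norm_zero] at hpw
  exact hw0 (norm_eq_zero.1 hpw.symm)

/-- A homeomorphism of the sphere fixing `∞` restricts to a homeomorphism of the plane. -/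
theorem exists_homeomorph_plane (h : OnePoint ℂ ≃ₜ OnePoint ℂ) (hinf : h ∞ = ∞) :
    ∃ φ : ℂ ≃ₜ ℂ, ∀ z : ℂ, h z = φ z := by
  have key : ∀ h : OnePoint ℂ ≃ₜ OnePoint ℂ, h ∞ = ∞ →
      ∃ φ : ℂ → ℂ, Continuous φ ∧ ∀ z : ℂ, h z = φ z := by
    intro h hinf
    have hne : ∀ z : ℂ, h z ≠ ∞ := fun z e => coe_ne_infty z (h.injective (e.trans hinf.symm))
    choose φ hφ using fun z => ne_infty_iff_exists.1 (hne z)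
    refine ⟨φ, ?_, fun z => (hφ z).symm⟩
    rw [isOpenEmbedding_coe.isEmbedding.continuous_iff]
    exact (h.continuous.comp continuous_coe).congr fun z => (hφ z).symm
  obtain ⟨φ, hφc, hφ⟩ := key h hinf
  obtain ⟨ψ, hψc, hψ⟩ := key h.symm (by rw [Homeomorph.symm_apply_eq, hinf])
  refine ⟨⟨⟨φ, ψ, fun z => ?_, fun z => ?_⟩, hφc, hψc⟩, hφ⟩
  · rw [← coe_eq_coe, ← hψ, ← hφ, h.symm_apply_apply]
  · rw [← coe_eq_coe, ← hφ, ← hψ, h.apply_symm_apply]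

theorem eq_or_eq_inv_of_conj {k m : ℂ} (hk : ‖k‖ = 1) (hk1 : k ≠ 1) (hm0 : m ≠ 0)
    (H : TopologicallyConjugate (sphereAffine k 0) (sphereAffine m 0)) : m = k ∨ m = k⁻¹ := by
  have hm := norm_eq_one_of_conj hk hk1 hm0 H
  have hk0 : k ≠ 0 := by rintro rfl; simp at hk
  -- Stated for arbitrary `k` because it is applied to `k⁻¹` as well, when the conjugacy moves `∞`.
  have main : ∀ k : ℂ, k ≠ 0 → k ≠ 1 → ∀ h : OnePoint ℂ ≃ₜ OnePoint ℂ,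
      (∀ x, sphereAffine k 0 (h x) = h (sphereAffine m 0 x)) → h ∞ = ∞ → k = m ∨ k = m⁻¹ := by
    intro k hk0 hk1 h hh hinf
    obtain ⟨φ, hφ⟩ := exists_homeomorph_plane h hinf
    have hconj : ∀ z, φ (m * z) = k * φ z := fun z => by
      have := hh z
      simp only [hφ, sphereAffine_coe, add_zero, coe_eq_coe] at this
      exact this.symm
    refine rotation_eq_or_eq_inv φ.continuous φ.symm.continuous φ.symm_apply_apply
      φ.apply_symm_apply ?_ hm hk0 hconj
    by_contra h0
    have := hconj 0
    rw [mul_zero] at this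
    exact hk1 (mul_right_cancel₀ h0 (by rw [← this, one_mul]))
  obtain ⟨h, hh⟩ := H.exists_semiconj
  have hinf := hh ∞
  rw [sphereAffine_infty] at hinf
  by_cases hi : h ∞ = ∞
  · rcases main k hk0 hk1 h hh hi with e | e
    · exact Or.inl e.symm
    · right; rw [e, inv_inv]
  -- Here `h ∞` is a finite fixed point of the rotation, so it is `0`; composing with inversion
  -- restores `∞` and replaces `k` by `k⁻¹`.
  · obtain ⟨p, hp⟩ := ne_infty_iff_exists.1 hi
    have hp0 : p = 0 := by
      by_contra hp0
      rw [← hp, sphereAffine_coe, coe_eq_coe, add_zero] at hinf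
      exact hk1 (mul_right_cancel₀ hp0 (by rw [hinf, one_mul]))
    subst hp0
    have hk' : ∀ x, sphereAffine k⁻¹ 0 (sphereInv x) = sphereInv (sphereAffine k 0 x) := by
      intro x
      cases x with
      | infty => simp
      | coe z =>
        by_cases hz : z = 0
        · simp [hz]
        · have : k * z ≠ 0 := mul_ne_zero hk0 hz
          rw [sphereAffine_coe, add_zero, sphereInv_coe hz, sphereInv_coe this]
          simp [mul_comm]
    rcases main k⁻¹ (inv_ne_zero hk0) (by simpa using hk1) (h.trans sphereInvHomeomorph)
      (fun x => by
        change sphereAffine k⁻¹ 0 (sphereInv (h x)) = sphereInv (h (sphereAffine m 0 x))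
        rw [hk', hh])
      (by change sphereInv (h ∞) = ∞; rw [← hp, sphereInv_zero]) with e | e
    · exact Or.inr e.symm
    · exact Or.inl (inv_injective e).symm

/-! ### Matrix formulas and normal forms. -/

namespace IsUnitMatrixOf

variable {M : SL(2, ℂ)} {f : OnePoint ℂ → OnePoint ℂ}

theorem apply_infty (hM : IsUnitMatrixOf M f) :
    f ∞ = if M.1 1 0 = 0 then ∞ else ((M.1 0 0 / M.1 1 0 : ℂ) : OnePoint ℂ) := by
  rw [hM, OnePoint.smul_infty_eq_ite]
  rfl

theorem apply_coe (hM : IsUnitMatrixOf M f) (z : ℂ) :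
    f z = if M.1 1 0 * z + M.1 1 1 = 0 then ∞ else
      (((M.1 0 0 * z + M.1 0 1) / (M.1 1 0 * z + M.1 1 1) : ℂ) : OnePoint ℂ) := by
  rw [hM, OnePoint.smul_some_eq_ite]
  rfl

/-- At a pole the default value `0` agrees with division by zero. -/
theorem finitePart_eq (hM : IsUnitMatrixOf M f) :
    finitePart f = fun z => (M.1 0 0 * z + M.1 0 1) / (M.1 1 0 * z + M.1 1 1) := by
  funext z
  rw [finitePart, hM.apply_coe]
  split_ifs with h
  · simp [h]
  · simp

end IsUnitMatrixOf

theorem Matrix.SpecialLinearGroup.det_eq_one_fin_two (M : SL(2, ℂ)) :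
    M.1 0 0 * M.1 1 1 - M.1 0 1 * M.1 1 0 = 1 := by
  rw [← Matrix.det_fin_two, M.2]

/-- A nonidentity Möbius transformation is conjugate to a dilation or to a translation. -/
theorem IsUnitMatrixOf.exists_normalForm {M : SL(2, ℂ)} {f : OnePoint ℂ → OnePoint ℂ}
    (hM : IsUnitMatrixOf M f) (hf : f ≠ id) :
    ∃ l : ℂ, l ≠ 0 ∧ M.1.trace = l + l⁻¹ ∧
      (l ^ 2 ≠ 1 ∧ TopologicallyConjugate f (sphereAffine (l ^ 2) 0) ∨
        l ^ 2 = 1 ∧ TopologicallyConjugate f (sphereAffine 1 1)) := by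
  have hdet := Matrix.SpecialLinearGroup.det_eq_one_fin_two M
  have hinf := hM.apply_infty
  have hcoe := hM.apply_coe
  rw [Matrix.trace_fin_two]
  generalize M.1 0 0 = a at *
  generalize M.1 0 1 = b at *
  generalize M.1 1 0 = c at *
  generalize M.1 1 1 = d at *
  suffices H : ∃ l t : ℂ, l ≠ 0 ∧ a + d = l + l⁻¹ ∧
      TopologicallyConjugate f (sphereAffine (l ^ 2) t) by
    obtain ⟨l, t, hl, htr, hc⟩ := H
    refine ⟨l, hl, htr, ?_⟩
    by_cases h1 : l ^ 2 = 1
    · refine Or.inr ⟨h1, ?_⟩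
      rw [h1] at hc
      refine hc.trans (sphereAffine_one_conj ?_)
      -- With `l ^ 2 = 1` and no translation part, `f` would be conjugate to the identity.
      rintro rfl
      obtain ⟨h, hh⟩ := hc.exists_semiconj
      refine hf (funext fun x => ?_)
      obtain ⟨y, rfl⟩ := h.surjective x
      rw [hh]
      cases y <;> simp
    · exact Or.inl ⟨h1, hc.trans (sphereAffine_conj_mul h1 t)⟩
  by_cases hc : c = 0
  · subst hc
    have had : a * d = 1 := by linear_combination hdet
    have ha : a ≠ 0 := left_ne_zero_of_mul_eq_one had
    have hd : d ≠ 0 := right_ne_zero_of_mul_eq_one had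
    refine ⟨a, a * b, ha, by rw [eq_inv_of_mul_eq_one_right had], ?_⟩
    have : f = sphereAffine (a ^ 2) (a * b) := by
      funext x
      cases x with
      | infty => simp [hinf]
      | coe z =>
        rw [hcoe, zero_mul, zero_add, if_neg hd, sphereAffine_coe, coe_eq_coe, div_eq_iff hd]
        linear_combination (-a * z - b) * had
    rw [this]
    exact .refl _
  -- The root `p` is a finite fixed point, and `w ↦ w⁻¹ + p` sends `∞` to it. The vector `(p, 1)`
  -- has eigenvalue `c * p + d`; the other eigenvalue is `a - c * p`.
  · obtain ⟨s, hs⟩ := IsAlgClosed.exists_eq_mul_self (discrim c (d - a) (-b))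
    obtain ⟨p, hp⟩ := exists_quadratic_eq_zero hc ⟨s, hs⟩
    have he : (a - c * p) * (c * p + d) = 1 := by linear_combination hdet - c * hp
    have he0 : c * p + d ≠ 0 := right_ne_zero_of_mul_eq_one he
    have ha0 : a - c * p ≠ 0 := left_ne_zero_of_mul_eq_one he
    have hinv : (c * p + d)⁻¹ = a - c * p := (eq_inv_of_mul_eq_one_left he).symm
    refine ⟨c * p + d, c * (c * p + d), he0, by rw [hinv]; ring, ?_⟩
    refine .of_semiconj (sphereInvHomeomorph.trans (Homeomorph.addRight p).onePointCongr)
      fun x => ?_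
    change f ((sphereInv x).map (· + p)) = (sphereInv (sphereAffine _ _ x)).map (· + p)
    cases x with
    | infty =>
      rw [sphereInv_infty, sphereAffine_infty, sphereInv_infty, map_some, zero_add, hcoe,
        if_neg he0, coe_eq_coe, div_eq_iff he0]
      linear_combination -hp
    | coe w =>
      rw [sphereAffine_coe]
      by_cases hw : w = 0
      · subst hw
        have h1 : (c * p + d) ^ 2 * 0 + c * (c * p + d) ≠ 0 := by
          rw [mul_zero, zero_add]; exact mul_ne_zero hc he0
        rw [sphereInv_zero, map_infty, hinf, if_neg hc, sphereInv_coe h1, map_some, coe_eq_coe,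
          mul_zero, zero_add, mul_inv, hinv]
        field_simp
        ring
      · have h2 : c * (w⁻¹ + p) + d = ((c * p + d) * w + c) / w := by field_simp; ring
        have h3 : (c * p + d) ^ 2 * w + c * (c * p + d) = (c * p + d) * ((c * p + d) * w + c) := by
          ring
        rw [sphereInv_coe hw, map_some, hcoe, h2, h3]
        by_cases h4 : (c * p + d) * w + c = 0
        · simp [h4]
        · rw [if_neg (div_ne_zero h4 hw), sphereInv_coe (mul_ne_zero he0 h4), map_some,
            coe_eq_coe, mul_inv, hinv, div_eq_iff (div_ne_zero h4 hw), add_mul, mul_assoc,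
            ← mul_div_assoc, inv_mul_cancel₀ h4]
          field_simp
          linear_combination -w * hp

/-! ### Eigenvalues and multipliers. -/

theorem hasEigenvalue_toLin'_iff (M : SL(2, ℂ)) (l : ℂ) :
    Module.End.HasEigenvalue (Matrix.toLin' M.1) l ↔ l ≠ 0 ∧ M.1.trace = l + l⁻¹ := by
  have hdet : M.1.det = 1 := M.2
  rw [Module.End.hasEigenvalue_iff_isRoot_charpoly, Matrix.charpoly_toLin',
    Matrix.charpoly_fin_two, hdet]
  simp only [Polynomial.IsRoot.def, Polynomial.eval_add, Polynomial.eval_sub, Polynomial.eval_pow,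
    Polynomial.eval_X, Polynomial.eval_mul, Polynomial.eval_C]
  constructor
  · intro h
    have hl : l ≠ 0 := by rintro rfl; simp at h
    refine ⟨hl, ?_⟩
    field_simp
    linear_combination -h
  · rintro ⟨hl, h⟩
    rw [h]
    field_simp
    ring

theorem hasDerivAt_mobius {a b c d z : ℂ} (hdet : a * d - b * c = 1) (hz : c * z + d ≠ 0) :
    HasDerivAt (fun z => (a * z + b) / (c * z + d)) (((c * z + d)⁻¹) ^ 2) z := by
  have h1 : HasDerivAt (fun z => a * z + b) a z := by
    simpa using ((hasDerivAt_id z).const_mul a).add_const b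
  have h2 : HasDerivAt (fun z => c * z + d) c z := by
    simpa using ((hasDerivAt_id z).const_mul c).add_const d
  refine (h1.div h2 hz).congr_deriv ?_
  field_simp
  linear_combination hdet

/-- The multipliers of a Möbius transformation are the squares of the eigenvalues of its matrix. -/
theorem IsUnitMatrixOf.isMultiplier_iff {M : SL(2, ℂ)} {f : OnePoint ℂ → OnePoint ℂ}
    (hM : IsUnitMatrixOf M f) (μ : ℂ) :
    IsMultiplier f μ ↔
      ∃ l, Module.End.HasEigenvalue (Matrix.toLin' M.1) l ∧ μ = l ^ 2 := by
  simp only [hasEigenvalue_toLin'_iff]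
  have hdet := Matrix.SpecialLinearGroup.det_eq_one_fin_two M
  have hinf := hM.apply_infty
  have hcoe := hM.apply_coe
  rw [Matrix.trace_fin_two, IsMultiplier, hM.finitePart_eq]
  generalize M.1 0 0 = a at *
  generalize M.1 0 1 = b at *
  generalize M.1 1 0 = c at *
  generalize M.1 1 1 = d at *
  -- For `c = 0` the derivative is the constant `(d⁻¹) ^ 2`.
  have hatInf : c = 0 → Tendsto (fun z : ℂ => 1 / deriv (fun z => (a * z + b) / (c * z + d)) z)
      (Bornology.cobounded ℂ) (𝓝 (d ^ 2)) := by
    rintro rfl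
    have hd : d ≠ 0 := by rintro rfl; simp at hdet
    refine tendsto_const_nhds.congr fun z => ?_
    rw [(hasDerivAt_mobius hdet (z := z) (by simpa using hd)).deriv]
    simp
  constructor
  · rintro (⟨z, hz, hder⟩ | ⟨hfix, hlim⟩)
    · rw [hcoe] at hz
      split_ifs at hz with h0
      · exact absurd hz (infty_ne_coe z)
      rw [coe_eq_coe, div_eq_iff h0] at hz
      refine ⟨(c * z + d)⁻¹, ⟨inv_ne_zero h0, ?_⟩, hder.unique (hasDerivAt_mobius hdet h0)⟩
      rw [inv_inv, ← sub_eq_iff_eq_add, eq_comm]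
      refine inv_eq_of_mul_eq_one_left ?_
      linear_combination hdet + c * hz
    · have hc : c = 0 := by
        by_contra hc
        rw [hinf, if_neg hc] at hfix
        exact coe_ne_infty _ hfix
      refine ⟨d, ⟨?_, ?_⟩, tendsto_nhds_unique hlim (hatInf hc)⟩
      · rintro rfl; simp [hc] at hdet
      · rw [hc] at hdet
        rw [eq_inv_of_mul_eq_one_left (a := a) (b := d) (by linear_combination hdet)]
        ring
  · rintro ⟨l, ⟨hl, htr⟩, rfl⟩
    -- The two equations say that `(z, 1)` is an eigenvector for `l⁻¹`.
    have finite : ∀ z, c * z + d = l⁻¹ → a * z + b = z * l⁻¹ →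
        ∃ z₀ : ℂ, f z₀ = z₀ ∧
          HasDerivAt (fun z => (a * z + b) / (c * z + d)) (l ^ 2) z₀ := by
      intro z h1 h2
      have h0 : c * z + d ≠ 0 := by rw [h1]; exact inv_ne_zero hl
      refine ⟨z, ?_, ?_⟩
      · rw [hcoe, if_neg h0, coe_eq_coe, div_eq_iff h0, h1, h2]
      · simpa [h1] using hasDerivAt_mobius hdet h0
    have hll : l * l⁻¹ = 1 := mul_inv_cancel₀ hl
    by_cases hc : c = 0
    -- The eigenvalues are now `a` and `d`: `d` belongs to the fixed point `∞`, and `a ≠ d` to `b /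
    -- (d - a)`.
    · by_cases hld : l = d
      · subst hld
        exact Or.inr ⟨by rw [hinf, if_pos hc], hatInf hc⟩
      · left
        have had : a * d = 1 := by rw [hc] at hdet; linear_combination hdet
        have hmul : (l - d) * (l - a) = 0 := by linear_combination had - l * htr - hll
        have hla : l = a := sub_eq_zero.1
          ((mul_eq_zero.1 hmul).resolve_left (sub_ne_zero.2 hld))
        have hdl : d = l⁻¹ := by linear_combination htr + hla
        have hne : d - a ≠ 0 := sub_ne_zero.2 fun e => hld (by rw [hla, e])
        refine finite (b / (d - a)) (by rw [hc, hdl]; ring) ?_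
        rw [← hdl]
        field_simp
        ring
    · left
      refine finite ((l⁻¹ - d) / c) (by field_simp; ring) ?_
      field_simp
      have := htr
      field_simp at this
      linear_combination this - l ^ 2 * hdet

/-! ### Traces and the unit circle. -/

theorem norm_sq_eq_one_iff (z : ℂ) : ‖z ^ 2‖ = 1 ↔ ‖z‖ = 1 := by
  rw [norm_pow, pow_eq_one_iff_of_nonneg (norm_nonneg z) two_ne_zero]

/-- If `l + l⁻¹` is real, comparison with its conjugate shows that `l` is real or unimodular; for
real `l`, the bound `2` forces `(|l| - 1) ^ 2 ≤ 0`. Conversely, a unimodular `l` gives `2 * l.re`.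
-/
theorem add_inv_mem_segmentNegTwoTwo_iff {l : ℂ} (hl : l ≠ 0) :
    l + l⁻¹ ∈ segmentNegTwoTwo ↔ ‖l‖ = 1 := by
  constructor
  · rintro ⟨a, ha, ha', h⟩
    have hq : l * l + 1 = a * l := by field_simp at h; linear_combination h
    have hq' : starRingEnd ℂ l * starRingEnd ℂ l + 1 = a * starRingEnd ℂ l := by
      simpa using congrArg (starRingEnd ℂ) hq
    have hprod : (l - starRingEnd ℂ l) * (l * starRingEnd ℂ l - 1) = 0 := by
      linear_combination starRingEnd ℂ l * hq - l * hq'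
    rcases mul_eq_zero.1 hprod with h1 | h1
    · obtain ⟨x, rfl⟩ := Complex.conj_eq_iff_real.1 (sub_eq_zero.1 h1).symm
      have hx : x * x + 1 = a * x := by exact_mod_cast hq
      have : |x| = 1 := by
        have h2 : (|x| - 1) ^ 2 ≤ 0 := by
          have h3 : a * x ≤ 2 * |x| := by
            calc a * x ≤ |a * x| := le_abs_self _
              _ = |a| * |x| := abs_mul a x
              _ ≤ 2 * |x| := by gcongr; exact abs_le.2 ⟨by linarith, ha'⟩
          nlinarith [abs_mul_abs_self x]
        nlinarith [pow_eq_zero_iff (two_ne_zero) |>.1 (le_antisymm h2 (sq_nonneg (|x| - 1)))]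
      rwa [Complex.norm_real, Real.norm_eq_abs]
    · rw [sub_eq_zero, Complex.mul_conj, Complex.normSq_eq_norm_sq] at h1
      have h2 : ‖l‖ ^ 2 = 1 := by exact_mod_cast h1
      exact (pow_eq_one_iff_of_nonneg (norm_nonneg l) two_ne_zero).1 h2
  · intro h
    rw [Complex.inv_eq_conj h]
    have h1 := abs_le.1 ((Complex.abs_re_le_norm l).trans h.le)
    refine ⟨2 * l.re, by linarith, by linarith, ?_⟩
    rw [Complex.add_conj]

theorem add_inv_eq_add_inv_iff {l m : ℂ} (hl : l ≠ 0) (hm : m ≠ 0) :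
    l + l⁻¹ = m + m⁻¹ ↔ l = m ∨ l = m⁻¹ := by
  constructor
  · intro h
    have h1 : (l - m) * (l - m⁻¹) = 0 := by
      linear_combination l * h - mul_inv_cancel₀ hl + mul_inv_cancel₀ hm
    exact (mul_eq_zero.1 h1).imp sub_eq_zero.1 sub_eq_zero.1
  · rintro (rfl | rfl)
    · rfl
    · rw [inv_inv, add_comm]

/-- Negating the trace replaces `m` by `-m`; squaring absorbs this sign. -/
theorem add_inv_eq_or_neg_iff {l m : ℂ} (hl : l ≠ 0) (hm : m ≠ 0) :
    (l + l⁻¹ = m + m⁻¹ ∨ l + l⁻¹ = -(m + m⁻¹)) ↔ (l ^ 2 = m ^ 2 ∨ l ^ 2 = (m ^ 2)⁻¹) := by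
  have h1 : -(m + m⁻¹) = -m + (-m)⁻¹ := by rw [inv_neg]; ring
  rw [h1, add_inv_eq_add_inv_iff hl hm, add_inv_eq_add_inv_iff hl (neg_ne_zero.2 hm), ← inv_pow,
    sq_eq_sq_iff_eq_or_eq_neg, sq_eq_sq_iff_eq_or_eq_neg, inv_neg]
  tauto

/-- Nonidentity Möbius transformations are topologically conjugate iff both are loxodromic or
their traces agree up to sign. -/
theorem topologicallyConjugate_iff_trace {f g : OnePoint ℂ → OnePoint ℂ} (hf : f ≠ id) (hg : g ≠ id)
    {Mf Mg : SL(2, ℂ)} (hMf : IsUnitMatrixOf Mf f) (hMg : IsUnitMatrixOf Mg g) :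
    TopologicallyConjugate f g ↔
      (Mf.1.trace ∉ segmentNegTwoTwo ∧ Mg.1.trace ∉ segmentNegTwoTwo) ∨
        Mf.1.trace = Mg.1.trace ∨ Mf.1.trace = -Mg.1.trace := by
  obtain ⟨l, hl, hlt, hlf⟩ := hMf.exists_normalForm hf
  obtain ⟨m, hm, hmt, hmg⟩ := hMg.exists_normalForm hg
  have hl2 := pow_ne_zero 2 hl
  have hm2 := pow_ne_zero 2 hm
  rw [hlt, hmt, add_inv_mem_segmentNegTwoTwo_iff hl, add_inv_mem_segmentNegTwoTwo_iff hm,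
    add_inv_eq_or_neg_iff hl hm, ← norm_sq_eq_one_iff l, ← norm_sq_eq_one_iff m]
  rcases hlf with ⟨hl1, hlf⟩ | ⟨hl1, hlf⟩ <;> rcases hmg with ⟨hm1, hmg⟩ | ⟨hm1, hmg⟩
  · constructor
    · intro H
      have hc := (hlf.symm.trans H).trans hmg
      by_cases h1 : ‖l ^ 2‖ = 1
      · right
        rcases eq_or_eq_inv_of_conj h1 hl1 hm2 hc with e | e
        · exact Or.inl e.symm
        · right; rw [e, inv_inv]
      · exact Or.inl ⟨h1, fun h2 => h1 (norm_eq_one_of_conj h2 hm1 hl2 hc.symm)⟩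
    · intro H
      refine (hlf.trans ?_).trans hmg.symm
      rcases H with ⟨h1, h2⟩ | e | e
      · exact (sphereAffine_conj_two hl2 h1).trans (sphereAffine_conj_two hm2 h2).symm
      · rw [e]; exact .refl _
      · rw [e]; exact (sphereAffine_conj_inv hm2).symm
  -- A dilation against a translation: each algebraic alternative would contradict `l ^ 2 ≠ 1` or
  -- `‖m ^ 2‖ = 1`.
  · constructor
    · intro H
      exact absurd ((hlf.symm.trans H).trans hmg) (not_topologicallyConjugate_mul_translation _)
    · intro H
      simp [hm1, hl1] at H
  · constructor
    · intro H
      exact absurd ((hlf.symm.trans H).trans hmg).symm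
        (not_topologicallyConjugate_mul_translation _)
    · intro H
      rw [hl1] at H
      rcases H with ⟨h1, -⟩ | e | e
      · simp at h1
      · exact absurd e.symm hm1
      · exact absurd (inv_eq_one.1 e.symm) hm1
  · exact iff_of_true ((hlf.trans hmg.symm)) (by simp [hl1, hm1])

/-- On the unit circle inversion is conjugation; off it, the norm alternative already holds. -/
theorem norm_ne_one_or_sq_eq_or_inv_iff {l m : ℂ} :
    ((‖l‖ ≠ 1 ∧ ‖m‖ ≠ 1) ∨ l ^ 2 = m ^ 2 ∨ l ^ 2 = (m ^ 2)⁻¹) ↔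
      ((‖l‖ ≠ 1 ∧ ‖m‖ ≠ 1) ∨ l ^ 2 = m ^ 2 ∨ l ^ 2 = starRingEnd ℂ (m ^ 2)) := by
  by_cases h : ‖m‖ = 1
  · have : ‖m ^ 2‖ = 1 := by rw [norm_pow, h, one_pow]
    rw [Complex.inv_eq_conj this]
  · have norm_of_sq : ∀ x : ℂ, ‖x‖ ≠ 1 → l ^ 2 = x ^ 2 → ‖l‖ ≠ 1 := fun x hx e => by
      have : ‖l‖ ^ 2 = ‖x‖ ^ 2 := by rw [← norm_pow, e, norm_pow]
      rwa [(sq_eq_sq₀ (norm_nonneg _) (norm_nonneg _)).1 this]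
    have h1 := norm_of_sq m h
    have h2 := norm_of_sq m⁻¹ (by rwa [norm_inv, ne_eq, inv_eq_one])
    have h3 := norm_of_sq (starRingEnd ℂ m) (by rwa [Complex.norm_conj])
    rw [inv_pow] at h2
    rw [← map_pow] at h3
    tauto

/-! ### The four equivalent conditions. -/

theorem theorem1 (f g : OnePoint ℂ → OnePoint ℂ) (hf : IsMobius f) (hg : IsMobius g)
    (hf_ne : f ≠ id) (hg_ne : g ≠ id)
    (Mf Mg : SL(2, ℂ)) (hMf : IsUnitMatrixOf Mf f) (hMg : IsUnitMatrixOf Mg g) :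
    List.TFAE [
      TopologicallyConjugate f g,
      (Mf.1.trace ∉ segmentNegTwoTwo ∧ Mg.1.trace ∉ segmentNegTwoTwo) ∨
        Mf.1.trace = Mg.1.trace ∨ Mf.1.trace = -Mg.1.trace,
      ∀ l l' : ℂ, Module.End.HasEigenvalue (Matrix.toLin' Mf.1) l →
        Module.End.HasEigenvalue (Matrix.toLin' Mg.1) l' →
          (‖l‖ ≠ 1 ∧ ‖l'‖ ≠ 1) ∨ (l = l' ∨ l = -l') ∨
            (l = starRingEnd ℂ l' ∨ l = -starRingEnd ℂ l'),
      ∀ μ ν : ℂ, IsMultiplier f μ → IsMultiplier g ν →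
          (‖μ‖ ≠ 1 ∧ ‖ν‖ ≠ 1) ∨ μ = ν ∨ μ = starRingEnd ℂ ν] := by
  tfae_have 1 ↔ 2 := topologicallyConjugate_iff_trace hf_ne hg_ne hMf hMg
  -- Any single pair of eigenvalues already decides the trace condition. Since eigenvalues exist
  -- over `ℂ`, the quantified conditions are not vacuous and give it back.
  have key : ∀ l l' : ℂ, Module.End.HasEigenvalue (Matrix.toLin' Mf.1) l →
      Module.End.HasEigenvalue (Matrix.toLin' Mg.1) l' →
      (((Mf.1.trace ∉ segmentNegTwoTwo ∧ Mg.1.trace ∉ segmentNegTwoTwo) ∨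
        Mf.1.trace = Mg.1.trace ∨ Mf.1.trace = -Mg.1.trace) ↔
      ((‖l‖ ≠ 1 ∧ ‖l'‖ ≠ 1) ∨ l ^ 2 = l' ^ 2 ∨ l ^ 2 = starRingEnd ℂ (l' ^ 2))) := by
    intro l l' h h'
    obtain ⟨hl, htl⟩ := (hasEigenvalue_toLin'_iff Mf l).1 h
    obtain ⟨hl', htl'⟩ := (hasEigenvalue_toLin'_iff Mg l').1 h'
    rw [htl, htl', add_inv_mem_segmentNegTwoTwo_iff hl, add_inv_mem_segmentNegTwoTwo_iff hl',
      add_inv_eq_or_neg_iff hl hl', norm_ne_one_or_sq_eq_or_inv_iff]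
  tfae_have 2 ↔ 3 := by
    simp only [map_pow, sq_eq_sq_iff_eq_or_eq_neg] at key
    constructor
    · exact fun H l l' h h' => (key l l' h h').1 H
    · intro H
      obtain ⟨l, h⟩ := Module.End.exists_eigenvalue (Matrix.toLin' Mf.1)
      obtain ⟨l', h'⟩ := Module.End.exists_eigenvalue (Matrix.toLin' Mg.1)
      exact (key l l' h h').2 (H l l' h h')
  tfae_have 2 ↔ 4 := by
    simp only [hMf.isMultiplier_iff, hMg.isMultiplier_iff]
    constructor
    · rintro H _ _ ⟨l, h, rfl⟩ ⟨l', h', rfl⟩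
      simpa only [ne_eq, norm_sq_eq_one_iff] using (key l l' h h').1 H
    · intro H
      obtain ⟨l, h⟩ := Module.End.exists_eigenvalue (Matrix.toLin' Mf.1)
      obtain ⟨l', h'⟩ := Module.End.exists_eigenvalue (Matrix.toLin' Mg.1)
      refine (key l l' h h').2 ?_
      simpa only [ne_eq, norm_sq_eq_one_iff] using H _ _ ⟨l, h, rfl⟩ ⟨l', h', rfl⟩
  tfae_finish

end
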